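/- For a real-valued $\bar\omega\in C_c^\infty(\mathbb R^2)$ let $\bar v(x)=\frac1{2\pi}\int_{\mathbb R^2}\frac{(x-y)^\perp}{|x-y|^2}\,\bar\omega(y)\,dy$ be its velocity (Biot--Savart law $\bar v=\nabla^\perp\Delta^{-1}\bar\omega$), where $(z_1,z_2)^\perp=(-z_2,z_1)$, and let $$L=T+K,\qquad Tw=-\bar v\cdot\nabla w,\qquad Kw=-v\cdot\nabla\bar\omega,$$ be the linearization of the two-dimensional Euler equation in vorticity form around $\bar\omega$. Here $w\in L^2(\mathbb R^2;\mathbb C)$ is such that its Biot--Savart integral $v=\frac1{2\pi}\int\frac{(x-y)^\perp}{|x-y|^2}w(y)\,dy$ converges absolutely for almost every $x$, the expression $Tw=-\mathrm{div}(\bar v\,w)$ is understood in the sense of distributions, and $Tw$ and $Kw$ are in $L^2$. For $n\in\mathbb N$, $n\ge1$, let $$U_n=\{w\in L^2(\mathbb R^2;\mathbb C): w(re^{i\theta})=w_n(r)e^{in\theta}\text{ for some function }w_n\}.$$ A radially symmetric $\bar\omega$ is called an unstable vortex if, for some $n\ge1$, there are $0\ne w\in U_n$ and $\lambda\in\mathbb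 C$ with $\Re\lambda>0$ such that $Lw=\lambda w$. **Theorem.** There exists an unstable vortex $\bar\Omega\in C_c^\infty(\mathbb R^2)$ with zero mean, $\int_{\mathbb R^2}\bar\Omega\,dx=0$. -/

import Mathlib

open MeasureTheory
open scoped ContDiff

noncomputable section

namespace Euler2D

/-! The plane `ℝ²` is identified with `ℂ` through `x = x₁ + i x₂ = r e^{iθ}`; this carries the
Euclidean norm and the Lebesgue measure. All derivatives are real derivatives. A vector field with
values in `F²` (with `F = ℝ` or `F = ℂ`) is a function `ℂ → F × F`. -/

/-- The Biot-Savart kernel `z^⊥ / (2π|z|²)`, where `z^⊥ = (-z₂, z₁) = i z`. -/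
def kernel (z : ℂ) : ℂ := Complex.I * z / ((2 * Real.pi * ‖z‖ ^ 2 : ℝ) : ℂ)

/-- The velocity `v = ∇^⊥ Δ⁻¹ w`, written as the Biot-Savart integral
`v(x) = (1/2π) ∫ (x - y)^⊥ / |x - y|² w(y) dy`, of a real- or complex-valued vorticity `w`. -/
def velocity {F : Type*} [NormedAddCommGroup F] [NormedSpace ℝ F] (w : ℂ → F) (x : ℂ) : F × F :=
  (∫ y, (kernel (x - y)).re • w y, ∫ y, (kernel (x - y)).im • w y)

/-- The Biot-Savart integral of `w` converges absolutely at almost every point. -/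
def HasVelocity {F : Type*} [NormedAddCommGroup F] [NormedSpace ℝ F] (w : ℂ → F) : Prop :=
  ∀ᵐ x : ℂ, Integrable (fun y => (kernel (x - y)).re • w y) ∧
    Integrable (fun y => (kernel (x - y)).im • w y)

/-- The partial derivative `∂₁ f`. -/
def partialX (f : ℂ → ℝ) (x : ℂ) : ℝ := fderiv ℝ f x 1

/-- The partial derivative `∂₂ f`. -/
def partialY (f : ℂ → ℝ) (x : ℂ) : ℝ := fderiv ℝ f x Complex.I

/-- `f = T w` where `T w = - v̄ · ∇ w = - div (v̄ w)` in the sense of distributions, and `v̄` is the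
(divergence free) velocity of the background vorticity `Ω`:
`∫ (v̄ · ∇φ) w = ∫ φ f` for all test functions `φ ∈ C_c^∞(ℝ²)`. -/
def IsTransport (Ω : ℂ → ℝ) (w f : ℂ → ℂ) : Prop :=
  ∀ φ : ℂ → ℝ, ContDiff ℝ ∞ φ → HasCompactSupport φ →
    (∫ x, ((velocity Ω x).1 * partialX φ x + (velocity Ω x).2 * partialY φ x) • w x) =
      (∫ x, φ x • f x)

/-- `K w = - v · ∇Ω`, where `v` is the velocity of `w`. -/
def opK (Ω : ℂ → ℝ) (w : ℂ → ℂ) (x : ℂ) : ℂ :=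
  -(partialX Ω x • (velocity w x).1 + partialY Ω x • (velocity w x).2)

/-- `w` is in the domain of the operator `L = T + K` on `L²(ℝ²; ℂ)`, the linearization of the Euler
equation around `Ω`, and `L w = g`. -/
def IsLinearizedEuler (Ω : ℂ → ℝ) (w g : ℂ → ℂ) : Prop :=
  MemLp w 2 volume ∧ HasVelocity w ∧
    ∃ f : ℂ → ℂ, MemLp f 2 volume ∧ IsTransport Ω w f ∧ MemLp (opK Ω w) 2 volume ∧
      ∀ᵐ x : ℂ, g x = f x + opK Ω w x

/-- The space `U_n = {w ∈ L² : w(r e^{iθ}) = w_n(r) e^{inθ}}`. -/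
def MemU (n : ℕ) (w : ℂ → ℂ) : Prop :=
  MemLp w 2 volume ∧
    ∃ wn : ℝ → ℂ, ∀ᵐ x : ℂ, w x = wn ‖x‖ * Complex.exp (Complex.I * n * Complex.arg x)

/-- `Ω` is radially symmetric. -/
def IsVortex (Ω : ℂ → ℝ) : Prop := ∃ W : ℝ → ℝ, ∀ x : ℂ, Ω x = W ‖x‖

/-- The vortex `Ω` is unstable: for some `n ≥ 1`, the operator `L` has an eigenfunction
`0 ≠ w ∈ U_n` with an eigenvalue `μ` of positive real part. -/
def IsUnstable (Ω : ℂ → ℝ) : Prop :=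
  ∃ n : ℕ, 1 ≤ n ∧ ∃ (μ : ℂ) (w : ℂ → ℂ), 0 < μ.re ∧ MemU n w ∧ ¬ (∀ᵐ x : ℂ, w x = 0) ∧
    IsLinearizedEuler Ω w (fun x => μ * w x)

end Euler2D

end

noncomputable section

namespace Euler2D

open Set Filter Topology unitInterval ComplexConjugate Real

/-! ### The Rayleigh problem of a thin shear layer -/

/-! The instability is that of Kelvin and Helmholtz on a circle. A disc in rigid rotation inside
fluid at rest is a vortex sheet. For the wave number 3 its phase speeds solve `(1 - c)² + 2c² = 0`,
so they are not real. Smoothing the jump of the angular velocity `Z` over a thin layer of squared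
radii `1 ≤ s ≤ 1 + ε` should preserve the instability. Since the circulation `s Z(s)` vanishes
outside, the mean is zero.

To pass to the limit, write the stream function as `x³ h(s)` with `h = (Z - c) F / s`. The Rayleigh
equation becomes `(s² (Z - c)² F')' = 2 (Z - c)² F`, which contains no derivative of `Z`. As a
first-order system for `F` and the momentum `p = s² (Z - c)² F'`, in the variable `τ = (s - 1) / ε`,
it has right-hand sides of size `ε`. Hence it continues smoothly to `ε = 0`, where `F` and `p` are
constant and the edge conditions give the sheet relation. Its root is simple, so `modeMap` has a
surjective derivative there and the sheet mode persists (`exists_mode_of_small`).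

It remains to return to the Biot-Savart integral. Residues on circles give the radial velocity of
`x³ g(|x|²)` (`velocity_angular_radial`). Two first integrals of the Laplacian, `innerFlux` and
`outerFlux`, identify it with that of the stream function (`velocity_eigenfunction`). Then `T` and
`K` multiply the mode by `-3iZ` and `3i(Z - c)`, so `L` multiplies it by `-3ic`. -/

/-- The primitive vanishing at `0` of a continuous function on the unit interval. -/
def primitiveLM : C(I, ℂ) →ₗ[ℂ] C(I, ℂ) where
  toFun g := ⟨fun τ => ∫ t in (0 : ℝ)..τ, g (projIcc 0 1 zero_le_one t), by
    have h : Continuous fun t : ℝ => g (projIcc 0 1 zero_le_one t) := by fun_prop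
    exact (intervalIntegral.continuous_primitive
      (fun a b => h.intervalIntegrable a b) 0).comp continuous_subtype_val⟩
  map_add' g h := by
    ext τ
    simp only [ContinuousMap.coe_mk, ContinuousMap.add_apply]
    exact intervalIntegral.integral_add
      (Continuous.intervalIntegrable (by fun_prop) _ _)
      (Continuous.intervalIntegrable (by fun_prop) _ _)
  map_smul' a g := by
    ext τ
    simp

/-- The primitive vanishing at `0`, as a bounded operator. -/
def primitive : C(I, ℂ) →L[ℂ] C(I, ℂ) :=
  primitiveLM.mkContinuous 1 fun g => by
    rw [ContinuousMap.norm_le _ (by positivity)]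
    intro τ
    have h := intervalIntegral.norm_integral_le_of_norm_le_const (a := (0 : ℝ)) (b := τ)
      (f := fun t => g (projIcc 0 1 zero_le_one t)) (C := ‖g‖) (fun t _ => g.norm_coe_le_norm _)
    refine h.trans ?_
    rw [one_mul]
    have := τ.2.1
    have := τ.2.2
    refine mul_le_of_le_one_right (norm_nonneg _) ?_
    rw [sub_zero, abs_of_nonneg] <;> assumption

lemma primitive_apply (g : C(I, ℂ)) (τ : I) :
    primitive g τ = ∫ t in (0 : ℝ)..τ, g (projIcc 0 1 zero_le_one t) := rfl

lemma primitive_zero (g : C(I, ℂ)) : primitive g 0 = 0 := by simp [primitive_apply]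

lemma hasDerivAt_primitive (g : C(I, ℂ)) {τ : ℝ} (hτ : τ ∈ Ioo (0 : ℝ) 1) :
    HasDerivAt (fun t => primitive g (projIcc 0 1 zero_le_one t))
      (g (projIcc 0 1 zero_le_one τ)) τ := by
  have h : Continuous fun t : ℝ => g (projIcc 0 1 zero_le_one t) := by fun_prop
  refine (intervalIntegral.integral_hasDerivAt_right (h.intervalIntegrable 0 τ)
    (h.stronglyMeasurableAtFilter _ _) h.continuousAt).congr_of_eventuallyEq ?_
  filter_upwards [Ioo_mem_nhds hτ.1 hτ.2] with t ht
  rw [primitive_apply, projIcc_of_mem _ (Ioo_subset_Icc_self ht)]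

/-- The coordinate function of the unit interval. -/
def coordI : C(I, ℂ) := ⟨fun τ => ((τ : ℝ) : ℂ), by fun_prop⟩

/-- The angular velocity profile across the layer: it falls smoothly from `1` to `0`. -/
def stepI : C(I, ℂ) := ⟨fun τ => ((1 - Real.smoothTransition τ : ℝ) : ℂ), by
  have := Real.smoothTransition.continuous
  fun_prop⟩

/-- Unknowns of the rescaled Rayleigh problem: the width of the layer, the mode, its momentum and
the phase speed. -/
abbrev ModeSpace := ℂ × C(I, ℂ) × C(I, ℂ) × ℂ

/-- The square of the relative angular velocity. -/
def relSq (y : ModeSpace) : C(I, ℂ) := (stepI - y.2.2.2 • 1) ^ 2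

/-- The rescaled Rayleigh problem with its boundary conditions, with the width as first
component. -/
def modeMap (y : ModeSpace) : ModeSpace :=
  -- The width is copied to the output, so that solving with a prescribed width is a matter of
  -- surjectivity near the sheet mode.
  (y.1,
    y.2.1 - 1 - y.1 • primitive (y.2.2.1 * Ring.inverse ((1 + y.1 • coordI) ^ 2 * relSq y)),
    y.2.2.1 - (1 - y.2.2.2) ^ 2 • 1 - y.1 • ((2 : ℂ) • primitive (relSq y * y.2.1)),
    y.2.2.1 1 + 2 * (1 + y.1) * y.2.2.2 ^ 2 * y.2.1 1)

/-- The phase speed of the mode of the vortex sheet. -/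
def sheetSpeed : ℂ := ⟨1 / 3, √2 / 3⟩

/-- Dispersion relation of the sheet: with `F = 1` on both sides, the inner momentum `(1 - c)²` must
equal the outer one `-2c²`. -/
lemma sheetSpeed_eq : 3 * sheetSpeed ^ 2 - 2 * sheetSpeed + 1 = 0 := by
  have h : √2 * √2 = 2 := Real.mul_self_sqrt (by norm_num)
  apply Complex.ext <;> simp [sheetSpeed, pow_two] <;> ring_nf
  rw [pow_two, h]; norm_num

lemma sheetSpeed_im : 0 < sheetSpeed.im := by simp [sheetSpeed]

/-- The mode of the vortex sheet. -/
def sheetMode : ModeSpace := (0, 1, (1 - sheetSpeed) ^ 2 • 1, sheetSpeed)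

lemma modeMap_sheetMode : modeMap sheetMode = 0 := by
  have := sheetSpeed_eq
  simp only [modeMap, sheetMode, Prod.mk_eq_zero]
  refine ⟨trivial, by ext; simp, by ext; simp, ?_⟩
  simp
  linear_combination this

/-! ### Linearization at the vortex sheet -/

lemma isUnit_of_forall_ne_zero {f : C(I, ℂ)} (h : ∀ x, f x ≠ 0) : IsUnit f :=
  ContinuousMap.isUnit_iff_forall_ne_zero _ |>.2 h

lemma stepI_sub_ne_zero {c : ℂ} (hc : 0 < c.im) (τ : I) : (stepI - c • 1) τ ≠ 0 := by
  intro h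
  have := congrArg Complex.im h
  simp [stepI] at this
  exact hc.ne' this

lemma contDiff_relSq : ContDiff ℂ 1 relSq := by
  unfold relSq
  fun_prop

/-- The integral terms carry the width as a factor, which is zero at the sheet. Only their values
`N`, `M` there enter the derivative, so they need not be computed. -/
lemma exists_hasStrictFDerivAt_modeMap :
    ∃ N M : C(I, ℂ), ∃ D : ModeSpace →L[ℂ] ModeSpace, HasStrictFDerivAt modeMap D sheetMode ∧
      ∀ y : ModeSpace, D y = (y.1, y.2.1 - y.1 • N,
        y.2.2.1 + (2 * (1 - sheetSpeed) * y.2.2.2) • 1 - y.1 • M,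
        y.2.2.1 1 + 2 * sheetSpeed ^ 2 * y.1 + 2 * sheetSpeed ^ 2 * y.2.1 1
          + 4 * sheetSpeed * y.2.2.2) := by
  set N : ModeSpace → C(I, ℂ) := fun y =>
    primitive (y.2.2.1 * Ring.inverse ((1 + y.1 • coordI) ^ 2 * relSq y)) with hN
  set M : ModeSpace → C(I, ℂ) := fun y => (2 : ℂ) • primitive (relSq y * y.2.1) with hM
  have hrel := contDiff_relSq
  have hMd : ContDiffAt ℂ 1 M sheetMode := by
    have : ContDiff ℂ 1 fun y : ModeSpace => relSq y * y.2.1 := by fun_prop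
    exact ((primitive.contDiff.comp this).const_smul (2 : ℂ)).contDiffAt
  have hNd : ContDiffAt ℂ 1 N sheetMode := by
    have h1 : ContDiff ℂ 1 fun y : ModeSpace => (1 + y.1 • coordI) ^ 2 * relSq y := by fun_prop
    have hu : IsUnit ((1 + sheetMode.1 • coordI) ^ 2 * relSq sheetMode) := by
      refine isUnit_of_forall_ne_zero fun x => ?_
      have h0 : (1 + sheetMode.1 • coordI) ^ 2 * relSq sheetMode = relSq sheetMode := by
        have : sheetMode.1 • coordI = 0 := by ext; simp [sheetMode]
        rw [this]; simp
      rw [h0]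
      exact pow_ne_zero 2 (stepI_sub_ne_zero sheetSpeed_im x)
    obtain ⟨u, hu⟩ := hu
    have h2 := contDiffAt_ringInverse ℂ (n := 1) u
    rw [hu] at h2
    have h3 := h2.comp sheetMode h1.contDiffAt
    have h4 : ContDiffAt ℂ 1 (fun y : ModeSpace => y.2.2.1) sheetMode := by fun_prop
    exact primitive.contDiff.contDiffAt.comp sheetMode (h4.mul h3)
  have h1 := hasStrictFDerivAt_fst (𝕜 := ℂ) (p := sheetMode)
  have h2 := hasStrictFDerivAt_snd (𝕜 := ℂ) (p := sheetMode)
  have h21 := (hasStrictFDerivAt_fst (𝕜 := ℂ) (p := sheetMode.2)).comp sheetMode h2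
  have h22 := (hasStrictFDerivAt_snd (𝕜 := ℂ) (p := sheetMode.2)).comp sheetMode h2
  have h221 := (hasStrictFDerivAt_fst (𝕜 := ℂ) (p := sheetMode.2.2)).comp sheetMode h22
  have h222 := (hasStrictFDerivAt_snd (𝕜 := ℂ) (p := sheetMode.2.2)).comp sheetMode h22
  have hN' := h1.smul (hNd.hasStrictFDerivAt one_ne_zero)
  have hM' := h1.smul (hMd.hasStrictFDerivAt one_ne_zero)
  have e1 := (ContinuousMap.evalCLM ℂ (1 : I) : C(I, ℂ) →L[ℂ] ℂ).hasStrictFDerivAt.comp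
    sheetMode h21
  have e2 := (ContinuousMap.evalCLM ℂ (1 : I) : C(I, ℂ) →L[ℂ] ℂ).hasStrictFDerivAt.comp
    sheetMode h221
  have hc := ((h222.const_sub 1).pow 2).smul_const (1 : C(I, ℂ))
  have hlast := e2.add ((((h1.const_add 1).const_mul 2).mul (h222.pow 2)).mul e1)
  refine ⟨N sheetMode, M sheetMode, _,
    h1.prodMk (((h21.sub_const 1).sub hN').prodMk (((h221.sub hc).sub hM').prodMk hlast)), ?_⟩
  rintro ⟨e, a, b, d⟩
  have z1 : sheetMode.1 = 0 := rfl
  have z2 : sheetMode.2.1 = 1 := rfl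
  have z3 : sheetMode.2.2.2 = sheetSpeed := rfl
  refine Prod.ext ?_ (Prod.ext ?_ (Prod.ext ?_ ?_))
  · simp
  · simp [z1]
  · simp [z1, z3]
  · simp [z1, z2, z3]
    ring

theorem exists_mode_of_small :
    ∃ ε : ℝ, 0 < ε ∧ ∃ f p : C(I, ℂ), ∃ c : ℂ, 0 < c.im ∧ modeMap ((ε : ℂ), f, p, c) = ((ε : ℂ), 0, 0, 0) := by
  obtain ⟨N, M, D, hD, hD'⟩ := exists_hasStrictFDerivAt_modeMap
  have hsurj : D.range = ⊤ := by
    rw [LinearMap.range_eq_top]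
    rintro ⟨e, a, b, d⟩
    -- This is the derivative of the dispersion polynomial. Once the first three components are
    -- solved, it is the coefficient `-2(1 - c) + 4c` of the variation `δ` of the phase speed.
    have hne : 6 * sheetSpeed - 2 ≠ 0 := by
      intro h
      have := congrArg Complex.im h
      have h2 := sheetSpeed_im
      simp at this
      linarith
    set δ : ℂ := (d - b 1 - e * M 1 - 2 * sheetSpeed ^ 2 * e
      - 2 * sheetSpeed ^ 2 * (a 1 + e * N 1)) / (6 * sheetSpeed - 2) with hδ
    have hδ' : δ * (6 * sheetSpeed - 2) = _ := div_mul_cancel₀ _ hne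
    refine ⟨(e, a + e • N, b + e • M - (2 * (1 - sheetSpeed) * δ) • 1, δ), ?_⟩
    rw [ContinuousLinearMap.coe_coe, hD']
    refine Prod.ext rfl (Prod.ext ?_ (Prod.ext ?_ ?_))
    · simp
    · simp
    · simp
      linear_combination hδ'
  have hmap := hD.map_nhds_eq_of_surj hsurj
  rw [modeMap_sheetMode] at hmap
  have hopen : {y : ModeSpace | 0 < y.2.2.2.im} ∈ 𝓝 sheetMode := by
    refine IsOpen.mem_nhds (isOpen_lt continuous_const ?_) sheetSpeed_im
    fun_prop
  have himg := image_mem_map (m := modeMap) hopen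
  rw [hmap] at himg
  have hcont : Tendsto (fun ε : ℝ => (((ε : ℂ), 0, 0, 0) : ModeSpace)) (𝓝[>] 0) (𝓝 0) := by
    have : Continuous fun ε : ℝ => (((ε : ℂ), 0, 0, 0) : ModeSpace) := by fun_prop
    have h := this.tendsto 0
    exact (h.mono_left nhdsWithin_le_nhds)
  obtain ⟨ε, ⟨⟨e, f, p, c⟩, hc, h⟩, hε⟩ :=
    ((hcont.eventually himg).and self_mem_nhdsWithin).exists
  have he : e = ε := congrArg Prod.fst h
  subst he
  exact ⟨ε, hε, f, p, c, hc, h⟩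

/-- A smooth angular velocity profile `Z` (as a function of the squared radius), equal to `1` in
the unit disc and vanishing outside a larger disc, with a solution of the Rayleigh equation of
angular wave number `3`, regular at the origin and decaying at infinity, of phase speed `c` with
positive imaginary part. -/
theorem exists_profile : ∃ (Z : ℝ → ℝ) (R : ℝ) (c : ℂ) (F p : ℝ → ℂ),
    ContDiff ℝ ∞ Z ∧ 1 < R ∧ (∀ s ≤ 1, Z s = 1) ∧ (∀ s, R ≤ s → Z s = 0) ∧ 0 < c.im ∧
    Continuous F ∧ Continuous p ∧
    (∀ s ∈ Ioo 1 R, HasDerivAt F (p s / (s ^ 2 * (Z s - c) ^ 2)) s) ∧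
    (∀ s ∈ Ioo 1 R, HasDerivAt p (2 * (Z s - c) ^ 2 * F s) s) ∧
    F 1 = 1 ∧ p 1 = (1 - c) ^ 2 ∧ p R = -2 * R * c ^ 2 * F R := by
  obtain ⟨ε, hε, f, p, c, hc, h⟩ := exists_mode_of_small
  simp only [modeMap, Prod.mk.injEq, true_and] at h
  obtain ⟨hf, hp, hend⟩ := h
  set q : C(I, ℂ) := p * Ring.inverse ((1 + (ε : ℂ) • coordI) ^ 2 * relSq (ε, f, p, c)) with hq
  have hf' : ∀ τ, f τ = 1 + ε * primitive q τ := fun τ => by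
    have := congrArg (fun g : C(I, ℂ) => g τ) hf
    simp at this
    linear_combination this
  have hp' : ∀ τ, p τ = (1 - c) ^ 2 + ε * (2 * primitive (relSq (ε, f, p, c) * f) τ) := fun τ => by
    have := congrArg (fun g : C(I, ℂ) => g τ) hp
    simp at this
    linear_combination this
  have hrel : ∀ τ : I, relSq (ε, f, p, c) τ = (((1 - Real.smoothTransition τ : ℝ) : ℂ) - c) ^ 2 := by
    intro τ
    simp [relSq, stepI]
  have hu : ∀ τ : I, (1 + (ε : ℂ) • coordI) τ = ((1 + ε * τ : ℝ) : ℂ) := by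
    intro τ
    simp [coordI]
  have hune : ∀ τ : I, (1 + (ε : ℂ) • coordI) τ ≠ 0 := by
    intro τ
    rw [hu, Complex.ofReal_ne_zero]
    have := mul_nonneg hε.le τ.2.1
    linarith
  -- `Ring.inverse` is `0` off the units, so it is a pointwise inverse only because `c` is not real
  -- and `1 + ετ` is positive.
  have hq' : ∀ τ, q τ = p τ / ((1 + (ε : ℂ) • coordI) τ ^ 2 * relSq (ε, f, p, c) τ) := by
    intro τ
    have hne : ∀ x, ((1 + (ε : ℂ) • coordI) ^ 2 * relSq (ε, f, p, c) : C(I, ℂ)) x ≠ 0 := fun x =>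
      mul_ne_zero (pow_ne_zero 2 (hune x)) (pow_ne_zero 2 (stepI_sub_ne_zero hc x))
    have hun := Ring.mul_inverse_cancel _ (isUnit_of_forall_ne_zero hne)
    have := congrArg (fun g : C(I, ℂ) => g τ) hun
    have h2 := hne τ
    simp only [ContinuousMap.mul_apply, ContinuousMap.one_apply, ContinuousMap.pow_apply] at this h2
    rw [hq, eq_div_iff h2]
    simp only [ContinuousMap.mul_apply]
    linear_combination p τ * this
  let lay : ℝ → ℝ := fun s => (s - 1) / ε
  have hlay : ∀ s, HasDerivAt lay (1 / ε) s := fun s =>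
    ((hasDerivAt_id s).sub_const 1).div_const ε
  have hlaymem : ∀ s ∈ Ioo 1 (1 + ε), lay s ∈ Ioo (0 : ℝ) 1 := fun s hs =>
    ⟨div_pos (by linarith [hs.1]) hε, (div_lt_one hε).2 (by linarith [hs.2])⟩
  have hlay1 : lay 1 = 0 := by simp [lay]
  have hlayR : lay (1 + ε) = 1 := by simp [lay, hε.ne']
  have hεc : (ε : ℂ) ≠ 0 := Complex.ofReal_ne_zero.2 hε.ne'
  have hlaycont : Continuous lay := by fun_prop
  -- `projIcc` freezes `F` and `p` at their edge values outside the layer: they are continuous on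
  -- the line, and the equations hold inside the layer.
  refine ⟨fun s => 1 - Real.smoothTransition (lay s), 1 + ε, c,
    fun s => f (projIcc 0 1 zero_le_one (lay s)), fun s => p (projIcc 0 1 zero_le_one (lay s)),
    ?_, by linarith, ?_, ?_, hc, by fun_prop, by fun_prop, ?_, ?_, ?_, ?_, ?_⟩
  · exact contDiff_const.sub (Real.smoothTransition.contDiff.comp (by fun_prop))
  · intro s hs
    simp only [lay]
    rw [Real.smoothTransition.zero_of_nonpos (div_nonpos_of_nonpos_of_nonneg (by linarith) hε.le),
      sub_zero]
  · intro s hs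
    simp only [lay]
    rw [Real.smoothTransition.one_of_one_le ((one_le_div hε).2 (by linarith)), sub_self]
  · intro s hs
    have hm := hlaymem s hs
    have h1 := ((hasDerivAt_primitive q hm).scomp s (hlay s)).const_mul (ε : ℂ) |>.const_add 1
    simp only [hf']
    refine h1.congr_deriv ?_
    rw [hq', hu, hrel, projIcc_of_mem _ (Ioo_subset_Icc_self hm)]
    have : 1 + ε * lay s = s := by simp only [lay]; field_simp; ring
    simp only [this]
    rw [Complex.real_smul]
    push_cast
    field_simp
  · intro s hs
    have hm := hlaymem s hs
    have h1 := (((hasDerivAt_primitive (relSq (ε, f, p, c) * f) hm).scomp s (hlay s)).const_mul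
      (2 : ℂ)).const_mul (ε : ℂ) |>.const_add ((1 - c) ^ 2)
    simp only [hp']
    refine h1.congr_deriv ?_
    rw [ContinuousMap.mul_apply, hrel, projIcc_of_mem _ (Ioo_subset_Icc_self hm)]
    rw [Complex.real_smul]
    push_cast
    field_simp
  · simp only [hlay1, projIcc_left]
    rw [hf']
    have := primitive_zero q
    simp_all
  · simp only [hlay1, projIcc_left]
    rw [hp']
    have := primitive_zero (relSq (ε, f, p, c) * f)
    simp_all
  · simp only [hlayR, projIcc_right]
    push_cast
    have : (⟨1, right_mem_Icc.2 zero_le_one⟩ : I) = 1 := rfl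
    simp only [this]
    linear_combination hend

/-! ### Polar coordinates -/

lemma integrableOn_polar {f : ℂ → ℂ} (hf : Integrable f) :
    IntegrableOn (fun p : ℝ × ℝ => p.1 • f (circleMap 0 p.1 p.2)) (Ioi 0 ×ˢ Ioo (-π) π) := by
  have h1 : Integrable (f ∘ Complex.measurableEquivRealProd.symm) :=
    (Complex.volume_preserving_equiv_real_prod.symm).integrable_comp_emb
      Complex.measurableEquivRealProd.symm.measurableEmbedding |>.2 hf
  have h2 := (integrableOn_image_iff_integrableOn_abs_det_fderiv_smul volume
    (polarCoord.open_target.measurableSet)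
    (fun p _ => (hasFDerivAt_polarCoord_symm p).hasFDerivWithinAt) polarCoord.symm.injOn
    (f ∘ Complex.measurableEquivRealProd.symm)).1 h1.integrableOn
  refine h2.congr_fun (fun p hp => ?_) polarCoord.open_target.measurableSet
  have hp0 : 0 < p.1 := hp.1
  simp only [Function.comp, det_fderivPolarCoordSymm, abs_of_pos hp0,
    Complex.measurableEquivRealProd_symm_polarCoord_symm_apply]
  congr 2
  rw [Complex.polarCoord_symm_apply, circleMap_zero, Complex.exp_mul_I]
  push_cast
  ring

/-- Integration over the plane by integration over circles, with the squared radius as variable;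
one circle may be left out. -/
lemma integral_eq_of_circle {f : ℂ → ℂ} (hf : Integrable f) {Φ : ℝ → ℂ} (r₀ : ℝ)
    (h : ∀ r, 0 < r → r ≠ r₀ → ∫ θ in (-π)..π, f (circleMap 0 r θ) = Φ (r ^ 2)) :
    ∫ y, f y = (1 / 2) * ∫ s in Ioi (0 : ℝ), Φ s := by
  have h1 : ∫ y, f y = ∫ p in Ioi (0 : ℝ) ×ˢ Ioo (-π) π, p.1 • f (circleMap 0 p.1 p.2) := by
    rw [← Complex.integral_comp_polarCoord_symm]
    refine setIntegral_congr_fun polarCoord.open_target.measurableSet fun p _ => ?_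
    congr 2
    rw [Complex.polarCoord_symm_apply, circleMap_zero, Complex.exp_mul_I]
    push_cast
    ring
  rw [h1, Measure.volume_eq_prod, setIntegral_prod _ (integrableOn_polar hf)]
  -- Substitution `s = r²`, where `r dr = ds / 2`.
  rw [← integral_comp_rpow_Ioi_of_pos (g := Φ) (p := 2) two_pos, ← integral_const_mul]
  have hae : ∀ᵐ r : ℝ ∂volume.restrict (Ioi 0), r ≠ r₀ :=
    ae_restrict_of_ae (Measure.ae_ne volume r₀)
  refine integral_congr_ae ?_
  filter_upwards [hae, ae_restrict_mem measurableSet_Ioi] with r hr hr0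
  have h2 := h r hr0 hr
  rw [intervalIntegral.integral_of_le (by linarith [pi_pos]), integral_Ioc_eq_integral_Ioo] at h2
  rw [integral_smul, h2]
  simp only [Complex.real_smul]
  norm_num
  ring

/-- On the circle `dθ = dz / (iz)`. -/
lemma integral_circleMap_eq {G : ℂ → ℂ} {r : ℝ} (hr : 0 < r) :
    ∫ θ in (-π)..π, G (circleMap 0 r θ) = -Complex.I * ∮ z in C(0, r), z⁻¹ * G z := by
  have hper : Function.Periodic (fun θ => G (circleMap 0 r θ)) (2 * π) :=
    (periodic_circleMap 0 r).comp G
  have h := hper.intervalIntegral_add_eq (-π) 0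
  rw [show -π + 2 * π = π by ring, zero_add] at h
  rw [h, circleIntegral, ← intervalIntegral.integral_const_mul]
  refine intervalIntegral.integral_congr fun θ _ => ?_
  have hne : circleMap 0 r θ ≠ 0 := circleMap_ne_center hr.ne'
  simp only [deriv_circleMap, smul_eq_mul]
  field_simp
  rw [Complex.I_sq]
  ring

lemma circleIntegral_pow_div_of_lt {a : ℂ} {r : ℝ} (h : ‖a‖ < r) (m : ℕ) :
    ∮ z in C(0, r), (z - a)⁻¹ * z ^ m = 2 * π * Complex.I * a ^ m := by
  have hd : DiffContOnCl ℂ (fun z : ℂ => z ^ m) (Metric.ball 0 r) :=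
    (differentiable_pow m).diffContOnCl
  have := hd.circleIntegral_sub_inv_smul (w := a) (by simpa using h)
  simpa using this

lemma circleIntegral_pow_div_of_gt {a : ℂ} {r : ℝ} (hr : 0 < r) (h : r < ‖a‖) (m : ℕ) :
    ∮ z in C(0, r), (z - a)⁻¹ * z ^ m = 0 := by
  have hne : ∀ z ∈ Metric.closedBall (0 : ℂ) r, z - a ≠ 0 := by
    intro z hz h0
    rw [sub_eq_zero] at h0
    subst h0
    rw [mem_closedBall_zero_iff] at hz
    linarith
  refine Complex.circleIntegral_eq_zero_of_differentiable_on_off_countable hr.le countable_empty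
    ?_ ?_
  · exact ((continuousOn_id.sub continuousOn_const).inv₀ hne).mul (continuousOn_id.pow m)
  · intro z hz
    have := hne z (Metric.ball_subset_closedBall hz.1)
    fun_prop (disch := assumption)

/-! ### The Cauchy kernel against functions of given angular dependence -/

lemma integral_circle_cauchy_of_lt {x : ℂ} {r : ℝ} (hr : 0 < r) (h : r < ‖x‖) (m : ℕ) :
    ∫ θ in (-π)..π, x / (x - circleMap 0 r θ) * circleMap 0 r θ ^ (m + 1) = 0 := by
  rw [integral_circleMap_eq (G := fun y => x / (x - y) * y ^ (m + 1)) hr]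
  have : ∮ z in C(0, r), z⁻¹ * (x / (x - z) * z ^ (m + 1)) =
      ∮ z in C(0, r), (-x) * ((z - x)⁻¹ * z ^ m) := by
    refine circleIntegral.integral_congr hr.le fun z hz => ?_
    have hz0 : z ≠ 0 := ne_zero_of_mem_sphere hr.ne' ⟨z, hz⟩
    have : (z - x)⁻¹ = -(x - z)⁻¹ := by rw [← neg_sub, inv_neg]
    simp only [this, div_eq_mul_inv, pow_succ]
    field_simp
  rw [this, circleIntegral.integral_const_mul, circleIntegral_pow_div_of_gt hr h]
  simp

lemma integral_circle_cauchy_of_gt {x : ℂ} {r : ℝ} (h : ‖x‖ < r) (m : ℕ) :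
    ∫ θ in (-π)..π, x / (x - circleMap 0 r θ) * circleMap 0 r θ ^ (m + 1) =
      -2 * π * x ^ (m + 1) := by
  have hr : 0 < r := (norm_nonneg x).trans_lt h
  rw [integral_circleMap_eq (G := fun y => x / (x - y) * y ^ (m + 1)) hr]
  have : ∮ z in C(0, r), z⁻¹ * (x / (x - z) * z ^ (m + 1)) =
      ∮ z in C(0, r), (-x) * ((z - x)⁻¹ * z ^ m) := by
    refine circleIntegral.integral_congr hr.le fun z hz => ?_
    have hz0 : z ≠ 0 := ne_zero_of_mem_sphere hr.ne' ⟨z, hz⟩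
    have : (z - x)⁻¹ = -(x - z)⁻¹ := by rw [← neg_sub, inv_neg]
    simp only [this, div_eq_mul_inv, pow_succ]
    field_simp
  rw [this, circleIntegral.integral_const_mul, circleIntegral_pow_div_of_lt h]
  linear_combination (2 * π * x ^ (m + 1)) * Complex.I_sq

/-- On the circle `conj z = r² / z`, so the conjugate kernel is again meromorphic. Its pole is the
reflected point `r² / conj x`, which lies inside exactly when `r < |x|`. -/
lemma integral_circle_conj_cauchy {x : ℂ} (hx : x ≠ 0) {r : ℝ} (hr : 0 < r) (h : r ≠ ‖x‖)
    (m : ℕ) :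
    ∫ θ in (-π)..π, conj (x / (x - circleMap 0 r θ)) * circleMap 0 r θ ^ m =
      -Complex.I * ∮ z in C(0, r), (z - r ^ 2 / conj x)⁻¹ * z ^ m := by
  rw [integral_circleMap_eq (G := fun y => conj (x / (x - y)) * y ^ m) hr]
  congr 1
  refine circleIntegral.integral_congr hr.le fun z hz => ?_
  have hz0 : z ≠ 0 := ne_zero_of_mem_sphere hr.ne' ⟨z, hz⟩
  have hzr : ‖z‖ = r := by simpa using hz
  have hx' : conj x ≠ 0 := by simpa using hx
  have hxz : conj x - conj z ≠ 0 := by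
    rw [← map_sub]
    intro h0
    have : x = z := sub_eq_zero.1 ((map_eq_zero _).1 h0)
    exact h (by rw [this, hzr])
  have hzz : z * conj z = (r : ℂ) ^ 2 := by
    rw [Complex.mul_conj, Complex.normSq_eq_norm_sq, hzr]; push_cast; rfl
  have h2 : z - r ^ 2 / conj x = z * (conj x - conj z) / conj x := by
    rw [← hzz]; field_simp
  simp only [map_div₀, map_sub, h2]
  field_simp

lemma integral_circle_conj_cauchy_of_lt {x : ℂ} {r : ℝ} (hr : 0 < r) (h : r < ‖x‖) (m : ℕ) :
    ∫ θ in (-π)..π, conj (x / (x - circleMap 0 r θ)) * circleMap 0 r θ ^ m =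
      2 * π * (r ^ 2 / conj x) ^ m := by
  have hx : x ≠ 0 := norm_pos_iff.1 (hr.trans h)
  rw [integral_circle_conj_cauchy hx hr h.ne, circleIntegral_pow_div_of_lt]
  · linear_combination (-2 * π * (r ^ 2 / conj x) ^ m) * Complex.I_sq
  · rw [norm_div, norm_pow, Complex.norm_real, RCLike.norm_conj, norm_of_nonneg hr.le,
      div_lt_iff₀ (hr.trans h), pow_two]
    gcongr

lemma integral_circle_conj_cauchy_of_gt {x : ℂ} (hx : x ≠ 0) {r : ℝ} (h : ‖x‖ < r) (m : ℕ) :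
    ∫ θ in (-π)..π, conj (x / (x - circleMap 0 r θ)) * circleMap 0 r θ ^ m = 0 := by
  have hr : 0 < r := (norm_nonneg x).trans_lt h
  rw [integral_circle_conj_cauchy hx hr h.ne', circleIntegral_pow_div_of_gt hr]
  · simp
  · rw [norm_div, norm_pow, Complex.norm_real, RCLike.norm_conj, norm_of_nonneg hr.le,
      lt_div_iff₀ (norm_pos_iff.2 hx), pow_two]
    gcongr

/-! ### Integrability -/

lemma locallyIntegrable_inv : LocallyIntegrable (fun z : ℂ => z⁻¹) := by
  rw [locallyIntegrable_iff]
  intro k hk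
  obtain ⟨r, hr⟩ := hk.isBounded.subset_ball 0
  refine IntegrableOn.mono_set ?_ hr
  have h : IntegrableOn (fun z : ℂ => ‖z‖⁻¹) (Metric.ball 0 r) := by
    rw [integrableOn_fun_norm_addHaar volume (f := fun t : ℝ => t⁻¹), Complex.finrank_real_complex]
    refine IntegrableOn.congr_fun (f := fun _ => (1 : ℝ)) (by simp) (fun t ht => ?_)
      measurableSet_Ioo
    simp [ht.1.ne']
  refine h.mono' (Measurable.aestronglyMeasurable (by fun_prop)) (Eventually.of_forall fun z => ?_)
  simp

lemma integrable_inv_sub_mul {w : ℂ → ℂ} (hw : Continuous w) (hs : HasCompactSupport w) (x : ℂ) :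
    Integrable fun y => (x - y)⁻¹ * w y := by
  have h1 : Continuous fun z => w (x - z) := by fun_prop
  have h2 : HasCompactSupport fun z => w (x - z) :=
    hs.comp_homeomorph (Homeomorph.subLeft x)
  have h3 := locallyIntegrable_inv.integrable_smul_left_of_hasCompactSupport h1 h2
  refine (h3.comp_sub_left x).congr (Eventually.of_forall fun y => ?_)
  simp [mul_comm]

lemma integrable_cauchy {w : ℂ → ℂ} (hw : Continuous w) (hs : HasCompactSupport w) (x : ℂ) :
    Integrable fun y => x / (x - y) * w y := by
  refine ((integrable_inv_sub_mul hw hs x).const_mul x).congr (Eventually.of_forall fun y => ?_)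
  simp only [div_eq_mul_inv, mul_assoc]

lemma integrable_conj_cauchy {w : ℂ → ℂ} (hw : Continuous w) (hs : HasCompactSupport w) (x : ℂ) :
    Integrable fun y => conj (x / (x - y)) * w y := by
  refine (integrable_cauchy hw hs x).norm.mono' ?_ (Eventually.of_forall fun y => ?_)
  · refine AEStronglyMeasurable.mul ?_ hw.aestronglyMeasurable
    exact Measurable.aestronglyMeasurable (by fun_prop)
  · simp only [norm_mul, RCLike.norm_conj, le_refl]

/-- The function `y ^ m g(|y|²)` of angular wave number `m`. -/
def angular (m : ℕ) (g : ℝ → ℂ) (y : ℂ) : ℂ := y ^ m * g (‖y‖ ^ 2)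

lemma continuous_angular {m : ℕ} {g : ℝ → ℂ} (hg : Continuous g) : Continuous (angular m g) := by
  unfold angular
  fun_prop

lemma hasCompactSupport_of_norm_sq {E : Type*} [Zero E] {w : ℂ → E} {R : ℝ}
    (h : ∀ y, R ≤ ‖y‖ ^ 2 → w y = 0) : HasCompactSupport w := by
  refine HasCompactSupport.of_support_subset_isCompact
    (isCompact_closedBall (0 : ℂ) (√R)) fun y hy => ?_
  rw [mem_closedBall_zero_iff]
  by_contra hlt
  push Not at hlt
  exact hy (h y ((Real.sqrt_le_left (norm_nonneg y)).1 hlt.le))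

lemma hasCompactSupport_angular {m : ℕ} {g : ℝ → ℂ} {R : ℝ} (hg : ∀ s, R ≤ s → g s = 0) :
    HasCompactSupport (angular m g) :=
  hasCompactSupport_of_norm_sq fun y hy => by rw [angular, hg _ hy, mul_zero]

/-- Only circles with `r > |x|` contribute here, and only those with `r < |x|` to the conjugate
kernel. Together they give the two halves of the Green function at a fixed wave number. -/
lemma integral_cauchy_angular {m : ℕ} {g : ℝ → ℂ} {R : ℝ} (hg : Continuous g)
    (hR : ∀ s, R ≤ s → g s = 0) (x : ℂ) :
    ∫ y, x / (x - y) * angular (m + 1) g y =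
      -π * x ^ (m + 1) * ∫ s in Ioi (‖x‖ ^ 2), g s := by
  rw [integral_eq_of_circle
    (integrable_cauchy (continuous_angular hg) (hasCompactSupport_angular hR) x)
    (Φ := (Ioi (‖x‖ ^ 2)).indicator fun s => -2 * π * x ^ (m + 1) * g s) ‖x‖]
  · rw [setIntegral_indicator measurableSet_Ioi, inter_eq_right.2 (Ioi_subset_Ioi (by positivity)),
      integral_const_mul]
    ring
  · intro r hr hne
    have : ∀ θ, x / (x - circleMap 0 r θ) * angular (m + 1) g (circleMap 0 r θ) =
        (x / (x - circleMap 0 r θ) * circleMap 0 r θ ^ (m + 1)) * g (r ^ 2) := by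
      intro θ
      rw [angular, norm_circleMap_zero, sq_abs, mul_assoc]
    simp only [this, intervalIntegral.integral_mul_const]
    rcases lt_or_gt_of_ne hne with h | h
    · rw [integral_circle_cauchy_of_lt hr h, zero_mul, indicator_of_notMem]
      simp only [mem_Ioi, not_lt]
      gcongr
    · rw [integral_circle_cauchy_of_gt h, indicator_of_mem]
      simp only [mem_Ioi]
      gcongr

lemma integral_conj_cauchy_angular {m : ℕ} {g : ℝ → ℂ} {R : ℝ} (hg : Continuous g)
    (hR : ∀ s, R ≤ s → g s = 0) {x : ℂ} (hx : x ≠ 0) :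
    ∫ y, conj (x / (x - y)) * angular m g y =
      π / conj x ^ m * ∫ s in Ioc 0 (‖x‖ ^ 2), s ^ m * g s := by
  rw [integral_eq_of_circle
    (integrable_conj_cauchy (continuous_angular hg) (hasCompactSupport_angular hR) x)
    (Φ := (Iic (‖x‖ ^ 2)).indicator fun s => 2 * π / conj x ^ m * (s ^ m * g s)) ‖x‖]
  · rw [setIntegral_indicator measurableSet_Iic, Ioi_inter_Iic, integral_const_mul]
    ring
  · intro r hr hne
    have : ∀ θ, conj (x / (x - circleMap 0 r θ)) * angular m g (circleMap 0 r θ) =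
        (conj (x / (x - circleMap 0 r θ)) * circleMap 0 r θ ^ m) * g (r ^ 2) := by
      intro θ
      rw [angular, norm_circleMap_zero, sq_abs, mul_assoc]
    simp only [this, intervalIntegral.integral_mul_const]
    rcases lt_or_gt_of_ne hne with h | h
    · rw [integral_circle_conj_cauchy_of_lt hr h, indicator_of_mem]
      · push_cast
        rw [div_pow]
        ring
      · simp only [mem_Iic]
        gcongr
    · rw [integral_circle_conj_cauchy_of_gt hx h, zero_mul, indicator_of_notMem]
      simp only [mem_Iic, not_le]
      gcongr

/-! ### The Biot-Savart law -/

/-- Up to a constant the kernel is the conjugate Cauchy kernel, which makes residues available. At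
`z = 0` both sides are `0` by convention. -/
lemma kernel_eq (z : ℂ) : kernel z = Complex.I / (2 * π) * conj z⁻¹ := by
  rcases eq_or_ne z 0 with rfl | hz
  · simp [kernel]
  have hz' : conj z ≠ 0 := by simpa using hz
  have : ((2 * π * ‖z‖ ^ 2 : ℝ) : ℂ) = 2 * π * (z * conj z) := by
    rw [Complex.mul_conj, Complex.normSq_eq_norm_sq]; push_cast; ring
  have hpi : (π : ℂ) ≠ 0 := Complex.ofReal_ne_zero.2 pi_ne_zero
  rw [kernel, this, map_inv₀]
  field_simp

lemma norm_kernel (z : ℂ) : ‖kernel z‖ = (2 * π)⁻¹ * ‖z⁻¹‖ := by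
  rw [kernel_eq, norm_mul, norm_div, Complex.norm_I, RCLike.norm_conj, norm_mul,
    Complex.norm_real, norm_of_nonneg pi_pos.le, one_div]
  simp

lemma measurable_kernel : Measurable kernel := by
  unfold kernel
  fun_prop

lemma integrable_norm_kernel_mul {F : Type*} [NormedAddCommGroup F] {w : ℂ → F}
    (hw : Continuous w) (hs : HasCompactSupport w) (x : ℂ) :
    Integrable fun y => ‖kernel (x - y)‖ * ‖w y‖ := by
  have h := (integrable_inv_sub_mul (w := fun y => (‖w y‖ : ℂ)) (by fun_prop)
    (hs.comp_left (g := fun v => ((‖v‖ : ℝ) : ℂ)) (by simp)) x).norm.const_mul (2 * π)⁻¹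
  refine h.congr (Eventually.of_forall fun y => ?_)
  simp [norm_kernel, mul_assoc]

section HasVelocity

variable {F : Type*} [NormedAddCommGroup F] [NormedSpace ℝ F] [SecondCountableTopology F]
  {w : ℂ → F}

lemma integrable_re_kernel_smul (hw : Continuous w) (hs : HasCompactSupport w) (x : ℂ) :
    Integrable fun y => (kernel (x - y)).re • w y := by
  refine (integrable_norm_kernel_mul hw hs x).mono' ?_ (Eventually.of_forall fun y => ?_)
  · refine AEStronglyMeasurable.smul ?_ hw.aestronglyMeasurable
    have := measurable_kernel
    exact Measurable.aestronglyMeasurable (by fun_prop)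
  · rw [norm_smul]
    gcongr
    exact Complex.abs_re_le_norm _

lemma integrable_im_kernel_smul (hw : Continuous w) (hs : HasCompactSupport w) (x : ℂ) :
    Integrable fun y => (kernel (x - y)).im • w y := by
  refine (integrable_norm_kernel_mul hw hs x).mono' ?_ (Eventually.of_forall fun y => ?_)
  · refine AEStronglyMeasurable.smul ?_ hw.aestronglyMeasurable
    have := measurable_kernel
    exact Measurable.aestronglyMeasurable (by fun_prop)
  · rw [norm_smul]
    gcongr
    exact Complex.abs_im_le_norm _

lemma hasVelocity_of_continuous (hw : Continuous w) (hs : HasCompactSupport w) : HasVelocity w :=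
  Eventually.of_forall fun x => ⟨integrable_re_kernel_smul hw hs x, integrable_im_kernel_smul hw hs x⟩

end HasVelocity

/-- The velocity of a vortex: it is azimuthal, and given by the circulation. -/
lemma velocity_vortex {W : ℝ → ℝ} {R : ℝ} (hW : Continuous W) (hR : ∀ s, R ≤ s → W s = 0)
    {x : ℂ} (hx : x ≠ 0) :
    velocity (fun y => W (‖y‖ ^ 2)) x =
      (-((∫ s in Ioc 0 (‖x‖ ^ 2), W s) / (2 * ‖x‖ ^ 2)) * x.im,
        (∫ s in Ioc 0 (‖x‖ ^ 2), W s) / (2 * ‖x‖ ^ 2) * x.re) := by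
  set Ω : ℂ → ℝ := fun y => W (‖y‖ ^ 2) with hΩ
  have hΩc : Continuous Ω := by fun_prop
  have hΩs : HasCompactSupport Ω := hasCompactSupport_of_norm_sq fun y hy => hR _ hy
  set C : ℝ := ∫ s in Ioc 0 (‖x‖ ^ 2), W s with hC
  have hx' : conj x ≠ 0 := by simpa using hx
  have hpi : (π : ℂ) ≠ 0 := Complex.ofReal_ne_zero.2 pi_ne_zero
  have hK : ∀ y, kernel (x - y) * Ω y = Complex.I / (2 * π * conj x) *
      (conj (x / (x - y)) * angular 0 (fun s => (W s : ℂ)) y) := by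
    intro y
    rw [kernel_eq, angular, map_div₀, map_inv₀]
    simp only [hΩ, pow_zero, one_mul]
    field_simp
  have hWc : Continuous fun s => (W s : ℂ) := by fun_prop
  have hWR : ∀ s, R ≤ s → (W s : ℂ) = 0 := fun s hs => by rw [hR s hs, Complex.ofReal_zero]
  have hint : ∫ y, kernel (x - y) * Ω y = Complex.I * x * (C / (2 * ‖x‖ ^ 2) : ℝ) := by
    simp only [hK]
    rw [integral_const_mul, integral_conj_cauchy_angular hWc hWR hx]
    have h1 : ∫ s in Ioc 0 (‖x‖ ^ 2), (s : ℂ) ^ 0 * (W s : ℂ) = (C : ℂ) := by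
      simp only [pow_zero, one_mul]
      exact integral_ofReal
    have h2 : ((‖x‖ : ℝ) : ℂ) ^ 2 = x * conj x := by
      rw [Complex.mul_conj, Complex.normSq_eq_norm_sq]; push_cast; rfl
    rw [h1]
    push_cast
    rw [h2]
    field_simp
  have hi : Integrable fun y => kernel (x - y) * Ω y := by
    simp only [hK]
    exact (integrable_conj_cauchy (continuous_angular hWc) (hasCompactSupport_angular hWR) x).const_mul _
  have hre := integral_re hi
  have him := integral_im hi
  simp only [hint] at hre him
  have hRe : ∀ y, RCLike.re (kernel (x - y) * (Ω y : ℂ)) = (kernel (x - y)).re • Ω y := by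
    intro y; simp
  have hIm : ∀ y, RCLike.im (kernel (x - y) * (Ω y : ℂ)) = (kernel (x - y)).im • Ω y := by
    intro y; simp
  simp only [hRe] at hre
  simp only [hIm] at him
  rw [velocity, hre, him]
  refine Prod.ext ?_ ?_
  · simp only [RCLike.re_eq_complex_re, Complex.re_mul_ofReal]
    simp; ring
  · simp only [RCLike.im_eq_complex_im, Complex.im_mul_ofReal]
    simp; ring

/-- The radial component of the velocity of a vorticity of angular wave number `m + 1`. -/
lemma velocity_angular_radial {m : ℕ} {g : ℝ → ℂ} {R : ℝ} (hg : Continuous g)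
    (hR : ∀ s, R ≤ s → g s = 0) {x : ℂ} (hx : x ≠ 0) :
    x.re • (velocity (angular (m + 1) g) x).1 + x.im • (velocity (angular (m + 1) g) x).2 =
      Complex.I / 4 * (x ^ (m + 1) * (∫ s in Ioi (‖x‖ ^ 2), g s) +
        1 / conj x ^ (m + 1) * ∫ s in Ioc 0 (‖x‖ ^ 2), s ^ (m + 1) * g s) := by
  have hwc := continuous_angular (m := m + 1) hg
  have hws := hasCompactSupport_angular (m := m + 1) hR
  have hpi : (π : ℂ) ≠ 0 := Complex.ofReal_ne_zero.2 pi_ne_zero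
  have h1 : Integrable fun y => x.re • (kernel (x - y)).re • angular (m + 1) g y :=
    (integrable_re_kernel_smul hwc hws x).smul x.re
  have h2 : Integrable fun y => x.im • (kernel (x - y)).im • angular (m + 1) g y :=
    (integrable_im_kernel_smul hwc hws x).smul x.im
  rw [velocity, ← integral_smul, ← integral_smul, ← integral_add h1 h2]
  have h : ∀ y, x.re • (kernel (x - y)).re • angular (m + 1) g y +
      x.im • (kernel (x - y)).im • angular (m + 1) g y =
      -Complex.I / (4 * π) * (x / (x - y) * angular (m + 1) g y) +
        Complex.I / (4 * π) * (conj (x / (x - y)) * angular (m + 1) g y) := by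
    intro y
    set t := (x - y)⁻¹ with ht
    -- The radial part of the kernel is an imaginary part, hence a difference of the two kernels
    -- already integrated.
    have e1 : (x.re * (kernel (x - y)).re + x.im * (kernel (x - y)).im : ℝ) =
        (x / (x - y)).im / (2 * π) := by
      have hk : Complex.I / (2 * π) = ((1 / (2 * π) : ℝ) : ℂ) * Complex.I := by
        push_cast; ring
      rw [kernel_eq, div_eq_mul_inv x, ← ht, hk, mul_assoc, Complex.re_ofReal_mul,
        Complex.im_ofReal_mul]
      simp
      ring
    have e2 : x / (x - y) - conj (x / (x - y)) = (2 * (x / (x - y)).im : ℝ) * Complex.I :=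
      Complex.sub_conj _
    rw [← smul_assoc, ← smul_assoc, ← add_smul, smul_eq_mul, smul_eq_mul, e1, Complex.real_smul]
    have e3 : ((((x / (x - y)).im / (2 * π) : ℝ)) : ℂ) =
        -Complex.I / (4 * π) * (x / (x - y) - conj (x / (x - y))) := by
      rw [e2]
      push_cast
      field_simp
      rw [Complex.I_sq]
      ring
    rw [e3]
    ring
  simp only [h]
  rw [integral_add ((integrable_cauchy hwc hws x).const_mul _)
    ((integrable_conj_cauchy hwc hws x).const_mul _), integral_const_mul, integral_const_mul,
    integral_cauchy_angular hg hR, integral_conj_cauchy_angular hg hR hx]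
  field_simp

/-! ### The unstable vortex -/

/-- A profile of angular velocity `Z`, as a function of the squared radius, together with an
unstable solution of its Rayleigh equation of angular wave number `3`. The phase speed is `c`; the
mode `F` and its momentum `p` are regular at the origin and decaying at infinity. -/
structure UnstableProfile where
  /-- the angular velocity -/
  Z : ℝ → ℝ
  /-- the squared radius outside which the fluid is at rest -/
  R : ℝ
  /-- the phase speed -/
  c : ℂ
  /-- the mode -/
  F : ℝ → ℂ
  /-- the momentum of the mode -/
  p : ℝ → ℂ
  contDiff_Z : ContDiff ℝ ∞ Z
  one_lt_R : 1 < R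
  Z_inner : ∀ s ≤ 1, Z s = 1
  Z_outer : ∀ s, R ≤ s → Z s = 0
  c_im : 0 < c.im
  continuous_F : Continuous F
  continuous_p : Continuous p
  hasDerivAt_F : ∀ s ∈ Ioo 1 R, HasDerivAt F (p s / (s ^ 2 * (Z s - c) ^ 2)) s
  hasDerivAt_p : ∀ s ∈ Ioo 1 R, HasDerivAt p (2 * (Z s - c) ^ 2 * F s) s
  F_one : F 1 = 1
  p_one : p 1 = (1 - c) ^ 2
  p_R : p R = -2 * R * c ^ 2 * F R

lemma nonempty_unstableProfile : Nonempty UnstableProfile := by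
  obtain ⟨Z, R, c, F, p, h1, h2, h3, h4, h5, h6, h7, h8, h9, h10, h11, h12⟩ := exists_profile
  exact ⟨⟨Z, R, c, F, p, h1, h2, h3, h4, h5, h6, h7, h8, h9, h10, h11, h12⟩⟩

lemma contDiff_deriv_of_infty {f : ℝ → ℝ} (h : ContDiff ℝ ∞ f) : ContDiff ℝ ∞ (deriv f) :=
  (contDiff_infty_iff_deriv.1 h).2

/-- The endpoint is included by continuity of the derivative; the edge conditions at `1` and `R`
rely on this. -/
lemma deriv_eq_zero_of_const_right {f : ℝ → ℝ} {b R : ℝ} (hf : Continuous (deriv f))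
    (h : ∀ s, R ≤ s → f s = b) : ∀ s, R ≤ s → deriv f s = 0 := by
  have h1 : Ioi R ⊆ {s | deriv f s = 0} := fun s hs => by
    have : f =ᶠ[𝓝 s] fun _ => b := by
      filter_upwards [Ioi_mem_nhds hs] with t ht using h t ht.le
    rw [mem_ofPred_eq, this.deriv_eq, deriv_const]
  have h2 := closure_minimal h1 (isClosed_eq hf continuous_const)
  rw [closure_Ioi] at h2
  exact fun s hs => h2 hs

lemma deriv_eq_of_linear_left {f : ℝ → ℝ} {a b R : ℝ} (hf : Continuous (deriv f))
    (h : ∀ s ≤ R, f s = a * s + b) : ∀ s ≤ R, deriv f s = a := by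
  have h1 : Iio R ⊆ {s | deriv f s = a} := fun s hs => by
    have : f =ᶠ[𝓝 s] fun t => a * t + b := by
      filter_upwards [Iio_mem_nhds hs] with t ht using h t ht.le
    rw [mem_ofPred_eq, this.deriv_eq]
    simp
  have h2 := closure_minimal h1 (isClosed_eq hf continuous_const)
  rw [closure_Iio] at h2
  exact fun s hs => h2 hs

lemma hasDerivAt_angular_circle {m : ℕ} (g : ℝ → ℂ) (ζ : ℝ → ℝ) {φ : ℂ → ℝ}
    (hφ : Differentiable ℝ φ) (r θ : ℝ) :
    HasDerivAt (fun θ => (ζ (r ^ 2) * g (r ^ 2)) *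
      ((φ (circleMap 0 r θ) : ℂ) * circleMap 0 r θ ^ m))
      ((ζ (‖circleMap 0 r θ‖ ^ 2) * fderiv ℝ φ (circleMap 0 r θ) (circleMap 0 r θ * Complex.I)) •
        angular m g (circleMap 0 r θ) - φ (circleMap 0 r θ) •
        (-m * Complex.I * ζ (‖circleMap 0 r θ‖ ^ 2) * angular m g (circleMap 0 r θ))) θ := by
  have h1 := hasDerivAt_circleMap 0 r θ
  have h2 : HasDerivAt (fun θ => (φ (circleMap 0 r θ) : ℂ))
      (fderiv ℝ φ (circleMap 0 r θ) (circleMap 0 r θ * Complex.I) : ℝ) θ :=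
    ((hφ (circleMap 0 r θ)).hasFDerivAt.comp_hasDerivAt θ h1).ofReal_comp
  refine ((h2.mul (h1.pow m)).const_mul _).congr_deriv ?_
  simp only [angular, norm_circleMap_zero, sq_abs, Complex.real_smul, Pi.pow_apply]
  rcases m with _ | m
  · push_cast; ring
  · rw [Nat.add_sub_cancel]
    push_cast
    ring

/-- Advection of a function of angular wave number `m` by an azimuthal flow. -/
lemma integral_azimuthal {m : ℕ} {g : ℝ → ℂ} {S : ℝ} (hg : Continuous g)
    (hS : ∀ s, S ≤ s → g s = 0) {ζ : ℝ → ℝ} (hζ : Continuous ζ) {φ : ℂ → ℝ}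
    (hφ : ContDiff ℝ ∞ φ) :
    ∫ x, (ζ (‖x‖ ^ 2) * fderiv ℝ φ x (x * Complex.I)) • angular m g x =
      ∫ x, φ x • (-m * Complex.I * ζ (‖x‖ ^ 2) * angular m g x) := by
  have hw := continuous_angular (m := m) hg
  have hφc := hφ.continuous
  have hφ' : Continuous fun x => fderiv ℝ φ x (x * Complex.I) :=
    (hφ.continuous_fderiv (by simp)).clm_apply (by fun_prop)
  have c1 : Continuous fun x => (ζ (‖x‖ ^ 2) * fderiv ℝ φ x (x * Complex.I)) • angular m g x := by
    fun_prop
  have c2 : Continuous fun x => φ x • (-m * Complex.I * ζ (‖x‖ ^ 2) * angular m g x) := by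
    fun_prop
  have i1 := c1.integrable_of_hasCompactSupport (μ := volume)
    (hasCompactSupport_of_norm_sq fun x hx => by rw [angular, hS _ hx, mul_zero, smul_zero])
  have i2 := c2.integrable_of_hasCompactSupport (μ := volume)
    (hasCompactSupport_of_norm_sq fun x hx => by rw [angular, hS _ hx]; simp)
  -- On each circle the difference of the two integrands is an exact angular derivative of a
  -- periodic function.
  have key : ∀ r : ℝ, ∫ θ in (-π)..π, ((ζ (‖circleMap 0 r θ‖ ^ 2) *
      fderiv ℝ φ (circleMap 0 r θ) (circleMap 0 r θ * Complex.I)) •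
        angular m g (circleMap 0 r θ) - φ (circleMap 0 r θ) •
        (-m * Complex.I * ζ (‖circleMap 0 r θ‖ ^ 2) * angular m g (circleMap 0 r θ))) = 0 := by
    intro r
    rw [intervalIntegral.integral_eq_sub_of_hasDerivAt
      (fun θ _ => hasDerivAt_angular_circle g ζ (hφ.differentiable (by simp)) r θ)
      (((c1.sub c2).comp (continuous_circleMap 0 r)).intervalIntegrable _ _)]
    have h := periodic_circleMap 0 r (-π)
    rw [show -π + 2 * π = π by ring] at h
    rw [h, sub_self]
  rw [← sub_eq_zero, ← integral_sub i1 i2]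
  refine (integral_eq_of_circle (i1.sub i2) (Φ := fun _ => 0) 0 (fun r _ _ => key r)).trans ?_
  simp

namespace UnstableProfile

variable (P : UnstableProfile)

/-- The circulation, up to the factor `2π`. -/
def circ (s : ℝ) : ℝ := s * P.Z s

/-- The vorticity as a function of the squared radius. -/
def vort (s : ℝ) : ℝ := 2 * deriv P.circ s

/-- The vortex. -/
def vortex (y : ℂ) : ℝ := P.vort (‖y‖ ^ 2)

/-- The vorticity of the unstable mode, without its angular factor. -/
def modeVort (s : ℝ) : ℂ := 4 * (deriv (deriv P.circ) s : ℝ) * P.F s / (max s 1 : ℝ)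

/-- The eigenfunction. -/
def eigenfunction : ℂ → ℂ := angular 3 P.modeVort

/-- The stream function of the unstable mode, without its angular factor. -/
def stream (s : ℝ) : ℂ := (P.Z s - P.c) * P.F s / s

/-! ### The background vortex: support, velocity and mean -/

lemma contDiff_circ : ContDiff ℝ ∞ P.circ := contDiff_id.mul P.contDiff_Z

lemma contDiff_deriv_circ : ContDiff ℝ ∞ (deriv P.circ) := contDiff_deriv_of_infty P.contDiff_circ

lemma contDiff_vort : ContDiff ℝ ∞ P.vort := contDiff_const.mul P.contDiff_deriv_circ

lemma continuous_deriv2_circ : Continuous (deriv (deriv P.circ)) :=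
  (contDiff_deriv_of_infty P.contDiff_deriv_circ).continuous

lemma deriv_circ_outer : ∀ s, P.R ≤ s → deriv P.circ s = 0 :=
  deriv_eq_zero_of_const_right P.contDiff_deriv_circ.continuous
    fun s hs => by rw [circ, P.Z_outer s hs, mul_zero]

lemma deriv_circ_inner : ∀ s ≤ 1, deriv P.circ s = 1 :=
  deriv_eq_of_linear_left (b := 0) P.contDiff_deriv_circ.continuous
    fun s hs => by rw [circ, P.Z_inner s hs]; ring

lemma deriv2_circ_outer : ∀ s, P.R ≤ s → deriv (deriv P.circ) s = 0 :=
  deriv_eq_zero_of_const_right P.continuous_deriv2_circ P.deriv_circ_outer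

lemma deriv2_circ_inner : ∀ s ≤ 1, deriv (deriv P.circ) s = 0 :=
  deriv_eq_of_linear_left (b := 1) P.continuous_deriv2_circ
    fun s hs => by rw [P.deriv_circ_inner s hs]; ring

lemma vort_outer (s : ℝ) (hs : P.R ≤ s) : P.vort s = 0 := by
  rw [vort, P.deriv_circ_outer s hs, mul_zero]

lemma contDiff_vortex : ContDiff ℝ ∞ P.vortex := P.contDiff_vort.comp (contDiff_norm_sq ℝ)

lemma hasCompactSupport_vortex : HasCompactSupport P.vortex :=
  hasCompactSupport_of_norm_sq fun _ hy => P.vort_outer _ hy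

lemma integral_vort {s : ℝ} (hs : 0 ≤ s) : ∫ t in Ioc 0 s, P.vort t = 2 * P.circ s := by
  rw [← intervalIntegral.integral_of_le hs]
  have h : ∀ t ∈ uIcc 0 s, HasDerivAt (fun t => 2 * P.circ t) (P.vort t) t := fun t _ =>
    ((P.contDiff_circ.differentiable (by simp)).differentiableAt.hasDerivAt).const_mul 2
  rw [intervalIntegral.integral_eq_sub_of_hasDerivAt h
    (P.contDiff_vort.continuous.intervalIntegrable _ _)]
  simp [circ]

lemma velocity_vortex {x : ℂ} (hx : x ≠ 0) :
    velocity P.vortex x = (-P.Z (‖x‖ ^ 2) * x.im, P.Z (‖x‖ ^ 2) * x.re) := by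
  have h := Euler2D.velocity_vortex P.contDiff_vort.continuous P.vort_outer hx
  have hx' : ‖x‖ ≠ 0 := norm_ne_zero_iff.2 hx
  rw [P.integral_vort (by positivity)] at h
  have h2 : 2 * P.circ (‖x‖ ^ 2) / (2 * ‖x‖ ^ 2) = P.Z (‖x‖ ^ 2) := by
    rw [circ]; field_simp
  rw [h2] at h
  exact h

/-- The total vorticity is proportional to the circulation `s Z(s)` at `s = R`, where `Z` vanishes.
-/
lemma integral_vortex : ∫ y, P.vortex y = 0 := by
  have hi : Integrable P.vortex :=
    P.contDiff_vortex.continuous.integrable_of_hasCompactSupport P.hasCompactSupport_vortex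
  have h := integral_eq_of_circle (f := fun y => (P.vortex y : ℂ)) hi.ofReal
    (Φ := fun s => (((2 * π) * P.vort s : ℝ) : ℂ)) 0 (fun r hr _ => by
      simp only [vortex, norm_circleMap_zero, sq_abs, intervalIntegral.integral_const]
      rw [Complex.real_smul]
      push_cast
      ring)
  have h2 : ∫ s in Ioi (0 : ℝ), (2 * π) * P.vort s = 0 := by
    rw [integral_const_mul, setIntegral_eq_of_subset_of_forall_sdiff_eq_zero measurableSet_Ioi
      (Ioc_subset_Ioi_self : Ioc 0 P.R ⊆ Ioi 0), P.integral_vort (by linarith [P.one_lt_R]),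
      circ, P.Z_outer _ le_rfl]
    · ring
    · intro s hs
      refine P.vort_outer s ?_
      by_contra hlt
      exact hs.2 ⟨hs.1, (not_le.1 hlt).le⟩
  have e1 : ∫ y, (P.vortex y : ℂ) = ((∫ y, P.vortex y : ℝ) : ℂ) := integral_ofReal
  have e2 : ∫ s in Ioi (0 : ℝ), (((2 * π) * P.vort s : ℝ) : ℂ) =
    ((∫ s in Ioi (0 : ℝ), (2 * π) * P.vort s : ℝ) : ℂ) := integral_ofReal
  rw [e1, e2, h2] at h
  simpa using h

lemma partial_vortex (x v : ℂ) : fderiv ℝ P.vortex x v =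
    4 * deriv (deriv P.circ) (‖x‖ ^ 2) * (x.re * v.re + x.im * v.im) := by
  have h1 : HasDerivAt P.vort (2 * deriv (deriv P.circ) (‖x‖ ^ 2)) (‖x‖ ^ 2) :=
    ((P.contDiff_deriv_circ.differentiable (by simp)).differentiableAt.hasDerivAt).const_mul 2
  have h2 := h1.comp_hasFDerivAt x (hasStrictFDerivAt_norm_sq x).hasFDerivAt
  have h3 : fderiv ℝ P.vortex x = _ := h2.fderiv
  rw [h3]
  simp
  ring

lemma Z_sub_c_ne_zero (s : ℝ) : (P.Z s - P.c : ℂ) ≠ 0 := by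
  intro h
  have := congrArg Complex.im h
  simp at this
  exact P.c_im.ne' this

/-- The denominator `max s 1` avoids the singularity of `1 / s` at the origin; the numerator
vanishes for `s ≤ 1` anyway. -/
lemma continuous_modeVort : Continuous P.modeVort := by
  have h1 := P.continuous_F
  have h2 := P.continuous_deriv2_circ
  have h3 : ∀ s : ℝ, ((max s 1 : ℝ) : ℂ) ≠ 0 := fun s =>
    Complex.ofReal_ne_zero.2 (by positivity)
  unfold modeVort
  fun_prop (disch := exact h3)

lemma modeVort_outer (s : ℝ) (hs : P.R ≤ s) : P.modeVort s = 0 := by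
  rw [modeVort, P.deriv2_circ_outer s hs]; simp

lemma modeVort_inner (s : ℝ) (hs : s ≤ 1) : P.modeVort s = 0 := by
  rw [modeVort, P.deriv2_circ_inner s hs]; simp

lemma modeVort_eq {s : ℝ} (hs : 1 ≤ s) :
    P.modeVort s = 4 * (deriv (deriv P.circ) s : ℝ) * P.F s / s := by
  rw [modeVort, max_eq_left hs]

lemma deriv_circ (s : ℝ) : deriv P.circ s = P.Z s + s * deriv P.Z s := by
  have h := ((hasDerivAt_id s).mul
    (P.contDiff_Z.differentiable (by simp)).differentiableAt.hasDerivAt).deriv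
  rw [show P.circ = id * P.Z from rfl, h]
  simp

lemma deriv2_circ (s : ℝ) :
    deriv (deriv P.circ) s = 2 * deriv P.Z s + s * deriv (deriv P.Z) s := by
  have h1 : deriv P.circ = fun s => P.Z s + s * deriv P.Z s := funext P.deriv_circ
  have h2 := ((P.contDiff_Z.differentiable (by simp)).differentiableAt.hasDerivAt (x := s)).add
    ((hasDerivAt_id s).mul ((contDiff_deriv_of_infty P.contDiff_Z).differentiable
      (by simp)).differentiableAt.hasDerivAt)
  rw [h1]
  refine h2.deriv.trans ?_
  simp
  ring

/-! ### The stream function of the mode as a Green potential -/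

lemma hasDerivAt_Z (s : ℝ) : HasDerivAt (fun s => (P.Z s : ℂ)) (deriv P.Z s : ℝ) s :=
  ((P.contDiff_Z.differentiable (by simp)).differentiableAt.hasDerivAt).ofReal_comp

lemma hasDerivAt_deriv_Z (s : ℝ) :
    HasDerivAt (fun s => ((deriv P.Z s : ℝ) : ℂ)) (deriv (deriv P.Z) s : ℝ) s :=
  (((contDiff_deriv_of_infty P.contDiff_Z).differentiable
    (by simp)).differentiableAt.hasDerivAt).ofReal_comp

/-- With `h` the stream function, this is `s ^ 4 h'(s)`. -/
def innerFlux (s : ℝ) : ℂ :=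
  s ^ 3 * (deriv P.Z s : ℝ) * P.F s + s * P.p s / (P.Z s - P.c) - s ^ 2 * (P.Z s - P.c) * P.F s

/-- With `h` the stream function, this is `s h'(s) + 3 h(s)`. -/
def outerFlux (s : ℝ) : ℂ :=
  (deriv P.Z s : ℝ) * P.F s + P.p s / (s ^ 2 * (P.Z s - P.c)) + 2 * (P.Z s - P.c) * P.F s / s

lemma flux_sub {s : ℝ} (hs : 0 < s) :
    P.innerFlux s / s ^ 3 - P.outerFlux s = -3 * P.stream s := by
  have h1 := P.Z_sub_c_ne_zero s
  have h2 : (s : ℂ) ≠ 0 := Complex.ofReal_ne_zero.2 hs.ne'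
  rw [innerFlux, outerFlux, stream]
  field_simp
  ring

/-- The Laplacian of `x³ h(|x|²)` is `4x³ (s h'' + 4h')`, and the Rayleigh equation makes it the
vorticity of the mode. The bracket is both `s⁻³ (s⁴ h')'` and `(s h' + 3h)'`, whence the two fluxes.
-/
lemma hasDerivAt_innerFlux {s : ℝ} (hs : s ∈ Ioo 1 P.R) :
    HasDerivAt P.innerFlux (s ^ 3 * P.modeVort s / 4) s := by
  have h1 := P.Z_sub_c_ne_zero s
  have h2 : (s : ℂ) ≠ 0 := Complex.ofReal_ne_zero.2 (by linarith [hs.1])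
  have hid : HasDerivAt (fun s : ℝ => (s : ℂ)) 1 s := Complex.ofRealCLM.hasDerivAt
  have hF := P.hasDerivAt_F s hs
  have hp := P.hasDerivAt_p s hs
  have hA := (P.hasDerivAt_Z s).sub_const P.c
  have h := ((((hid.pow 3).mul (P.hasDerivAt_deriv_Z s)).mul hF).add ((hid.mul hp).div hA h1)).sub
    (((hid.pow 2).mul hA).mul hF)
  refine h.congr_deriv ?_
  rw [P.modeVort_eq hs.1.le, P.deriv2_circ]
  simp only [Pi.mul_apply, Pi.pow_apply]
  push_cast
  field_simp
  ring

lemma hasDerivAt_outerFlux {s : ℝ} (hs : s ∈ Ioo 1 P.R) :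
    HasDerivAt P.outerFlux (P.modeVort s / 4) s := by
  have h1 := P.Z_sub_c_ne_zero s
  have h2 : (s : ℂ) ≠ 0 := Complex.ofReal_ne_zero.2 (by linarith [hs.1])
  have hid : HasDerivAt (fun s : ℝ => (s : ℂ)) 1 s := Complex.ofRealCLM.hasDerivAt
  have hF := P.hasDerivAt_F s hs
  have hp := P.hasDerivAt_p s hs
  have hA := (P.hasDerivAt_Z s).sub_const P.c
  have h := (((P.hasDerivAt_deriv_Z s).mul hF).add (hp.div ((hid.pow 2).mul hA)
    (mul_ne_zero (pow_ne_zero 2 h2) h1))).add (((hA.const_mul 2).mul hF).div hid h2)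
  refine h.congr_deriv ?_
  rw [P.modeVort_eq hs.1.le, P.deriv2_circ]
  simp only [Pi.mul_apply, Pi.pow_apply]
  push_cast
  field_simp
  ring

/-- Regularity at the origin: `h' = 0` at the edge matches a stream function proportional to `x³` in
the disc. -/
lemma innerFlux_one : P.innerFlux 1 = 0 := by
  have h := P.Z_sub_c_ne_zero 1
  have hd : deriv P.Z 1 = 0 := deriv_eq_of_linear_left (b := 1)
    (contDiff_deriv_of_infty P.contDiff_Z).continuous
    (fun s hs => by rw [P.Z_inner s hs]; ring) 1 le_rfl
  rw [P.Z_inner 1 le_rfl] at h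
  rw [innerFlux, hd, P.Z_inner 1 le_rfl, P.F_one, P.p_one]
  push_cast at h ⊢
  field_simp
  ring

/-- Decay at infinity: `s h' + 3h = 0` matches `h` proportional to `s⁻³` outside the layer. -/
lemma outerFlux_R : P.outerFlux P.R = 0 := by
  have h := P.Z_sub_c_ne_zero P.R
  have hR : (P.R : ℂ) ≠ 0 := Complex.ofReal_ne_zero.2 (by linarith [P.one_lt_R])
  have hd : deriv P.Z P.R = 0 := deriv_eq_zero_of_const_right
    (contDiff_deriv_of_infty P.contDiff_Z).continuous P.Z_outer P.R le_rfl
  rw [P.Z_outer P.R le_rfl] at h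
  have hc : P.c ≠ 0 := by simpa using h
  rw [outerFlux, hd, P.Z_outer P.R le_rfl, P.p_R]
  push_cast
  rw [zero_sub]
  field_simp
  ring

lemma continuousOn_innerFlux : ContinuousOn P.innerFlux (Icc 1 P.R) := by
  have h0 := (contDiff_deriv_of_infty P.contDiff_Z).continuous
  have h1 := P.contDiff_Z.continuous
  have h2 := P.continuous_F
  have h3 := P.continuous_p
  have h4 := P.Z_sub_c_ne_zero
  refine Continuous.continuousOn ?_
  unfold innerFlux
  fun_prop (disch := exact h4)

lemma continuousOn_outerFlux : ContinuousOn P.outerFlux (Icc 1 P.R) := by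
  have h0 := (contDiff_deriv_of_infty P.contDiff_Z).continuous
  have h1 := P.contDiff_Z.continuous
  have h2 := P.continuous_F
  have h3 := P.continuous_p
  have hs : ∀ s ∈ Icc 1 P.R, (s : ℂ) ≠ 0 := fun s hs =>
    Complex.ofReal_ne_zero.2 (by linarith [hs.1])
  have h4 : ∀ s ∈ Icc 1 P.R, (s : ℂ) ^ 2 * (P.Z s - P.c) ≠ 0 := fun s h =>
    mul_ne_zero (pow_ne_zero 2 (hs s h)) (P.Z_sub_c_ne_zero s)
  unfold outerFlux
  refine ContinuousOn.add (ContinuousOn.add ?_ (ContinuousOn.div ?_ ?_ h4))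
    (ContinuousOn.div ?_ ?_ hs)
  all_goals exact Continuous.continuousOn (by fun_prop)

lemma integral_inner {s : ℝ} (hs : s ∈ Icc 1 P.R) :
    ∫ t in Ioc 0 s, (t : ℂ) ^ 3 * P.modeVort t = 4 * P.innerFlux s := by
  have hc := P.continuous_modeVort
  rw [setIntegral_eq_of_subset_of_forall_sdiff_eq_zero measurableSet_Ioc
    (Ioc_subset_Ioc_left zero_le_one : Ioc 1 s ⊆ Ioc 0 s),
    ← intervalIntegral.integral_of_le hs.1]
  · have h := intervalIntegral.integral_eq_sub_of_hasDerivAt_of_le hs.1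
      (P.continuousOn_innerFlux.mono (Icc_subset_Icc_right hs.2))
      (fun t ht => P.hasDerivAt_innerFlux ⟨ht.1, ht.2.trans_le hs.2⟩)
      (Continuous.intervalIntegrable (by fun_prop) _ _)
    rw [intervalIntegral.integral_div, P.innerFlux_one] at h
    linear_combination 4 * h
  · intro t ht
    rw [P.modeVort_inner t, mul_zero]
    by_contra hlt
    exact ht.2 ⟨not_le.1 hlt, ht.1.2⟩

lemma integral_outer {s : ℝ} (hs : s ∈ Icc 1 P.R) :
    ∫ t in Ioi s, P.modeVort t = -4 * P.outerFlux s := by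
  have hc := P.continuous_modeVort
  rw [setIntegral_eq_of_subset_of_forall_sdiff_eq_zero measurableSet_Ioi
    (Ioc_subset_Ioi_self : Ioc s P.R ⊆ Ioi s),
    ← intervalIntegral.integral_of_le hs.2]
  · have h := intervalIntegral.integral_eq_sub_of_hasDerivAt_of_le hs.2
      (P.continuousOn_outerFlux.mono (Icc_subset_Icc_left hs.1))
      (fun t ht => P.hasDerivAt_outerFlux ⟨hs.1.trans_lt ht.1, ht.2⟩)
      (Continuous.intervalIntegrable (by fun_prop) _ _)
    rw [intervalIntegral.integral_div, P.outerFlux_R] at h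
    linear_combination 4 * h
  · intro t ht
    refine P.modeVort_outer t ?_
    by_contra hlt
    exact ht.2 ⟨ht.1, (not_le.1 hlt).le⟩

/-- In the support of `∇Ω`, the radial velocity of the eigenfunction is the angular derivative of
the stream function. -/
lemma velocity_eigenfunction {x : ℂ} (hx : ‖x‖ ^ 2 ∈ Icc 1 P.R) :
    x.re • (velocity P.eigenfunction x).1 + x.im • (velocity P.eigenfunction x).2 =
      -3 * Complex.I * x ^ 3 * P.stream (‖x‖ ^ 2) := by
  have hpos : 0 < ‖x‖ ^ 2 := by linarith [hx.1]
  have hx0 : x ≠ 0 := by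
    rintro rfl
    simp at hpos
  rw [eigenfunction, velocity_angular_radial (m := 2) P.continuous_modeVort P.modeVort_outer hx0,
    P.integral_outer hx, P.integral_inner hx]
  have h1 := P.flux_sub hpos
  have h2 : ((‖x‖ ^ 2 : ℝ) : ℂ) = x * conj x := by
    rw [Complex.mul_conj, Complex.normSq_eq_norm_sq]
  have hx' : conj x ≠ 0 := by simpa using hx0
  have h3 : (1 : ℂ) / conj x ^ 3 = x ^ 3 / ((‖x‖ ^ 2 : ℝ) : ℂ) ^ 3 := by
    rw [h2]; field_simp
  rw [show 2 + 1 = 3 from rfl, h3]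
  linear_combination (Complex.I * x ^ 3) * h1

/-! ### The eigenvalue equation -/

lemma opK_eigenfunction (x : ℂ) : opK P.vortex P.eigenfunction x =
    3 * Complex.I * (P.Z (‖x‖ ^ 2) - P.c) * P.eigenfunction x := by
  -- The gradient of the vortex is radial, so only the radial velocity of the mode matters, and only
  -- within the layer.
  have h : opK P.vortex P.eigenfunction x = -(4 * deriv (deriv P.circ) (‖x‖ ^ 2) : ℝ) *
      (x.re • (velocity P.eigenfunction x).1 + x.im • (velocity P.eigenfunction x).2) := by
    simp only [opK, partialX, partialY, partial_vortex, Complex.real_smul]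
    simp
    ring
  rw [h]
  by_cases hx : ‖x‖ ^ 2 ∈ Icc 1 P.R
  · rw [P.velocity_eigenfunction hx, eigenfunction, angular, P.modeVort_eq hx.1, stream]
    push_cast
    ring
  · have h0 : deriv (deriv P.circ) (‖x‖ ^ 2) = 0 := by
      rcases le_total (‖x‖ ^ 2) 1 with h1 | h1
      · exact P.deriv2_circ_inner _ h1
      · exact P.deriv2_circ_outer _ (not_lt.1 fun h2 => hx ⟨h1, h2.le⟩)
    rw [eigenfunction, angular, modeVort, h0]
    simp

lemma continuous_eigenfunction : Continuous P.eigenfunction :=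
  continuous_angular P.continuous_modeVort

lemma hasCompactSupport_eigenfunction : HasCompactSupport P.eigenfunction :=
  hasCompactSupport_angular P.modeVort_outer

lemma isTransport_eigenfunction : IsTransport P.vortex P.eigenfunction
    (fun x => -3 * Complex.I * P.Z (‖x‖ ^ 2) * P.eigenfunction x) := by
  intro φ hφ _
  have h := integral_azimuthal (m := 3) P.continuous_modeVort P.modeVort_outer
    P.contDiff_Z.continuous hφ
  refine Eq.trans (integral_congr_ae ?_) (h.trans ?_)
  · filter_upwards [Measure.ae_ne volume (0 : ℂ)] with x hx
    rw [P.velocity_vortex hx, eigenfunction]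
    have hx2 : x * Complex.I = (-x.im) • (1 : ℂ) + x.re • Complex.I := by
      apply Complex.ext <;> simp
    rw [hx2, map_add, map_smul, map_smul, partialX, partialY]
    congr 1
    simp only [smul_eq_mul]
    ring
  · rfl

lemma isUnstable_vortex : IsUnstable P.vortex := by
  have hc := P.continuous_eigenfunction
  have hs := P.hasCompactSupport_eigenfunction
  have hZ := P.contDiff_Z.continuous
  have hmem : ∀ ζ : ℂ → ℂ, Continuous ζ →
      MemLp (fun x => ζ x * P.eigenfunction x) 2 volume := fun ζ hζ =>
    Continuous.memLp_of_hasCompactSupport (by fun_prop) hs.mul_left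
  have hmemw : MemLp P.eigenfunction 2 volume := hc.memLp_of_hasCompactSupport hs
  -- The eigenvalue is the sum of the factors `-3iZ` and `3i(Z - c)`; its real part is `3 Im c`.
  refine ⟨3, by norm_num, -3 * Complex.I * P.c, P.eigenfunction, ?_,
    ⟨hmemw, fun r => r ^ 3 * P.modeVort (r ^ 2), Eventually.of_forall fun x => ?_⟩, ?_, hmemw,
    hasVelocity_of_continuous hc hs, _, hmem _ (by fun_prop), P.isTransport_eigenfunction, ?_, ?_⟩
  · have := P.c_im
    simp
    linarith
  · have h := Complex.norm_mul_exp_arg_mul_I x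
    have h2 : Complex.exp (Complex.I * (3 : ℕ) * x.arg) = Complex.exp (x.arg * Complex.I) ^ 3 := by
      rw [← Complex.exp_nat_mul]
      congr 1
      push_cast
      ring
    rw [h2, eigenfunction, angular]
    nth_rewrite 1 [← h]
    ring
  -- A null vorticity would have zero velocity, but the radial velocity at `x = 1` is `-3i(1 - c)`.
  · intro h0
    have hz : ‖(1 : ℂ)‖ ^ 2 = 1 := by simp
    have h1 := P.velocity_eigenfunction (x := 1) (by rw [hz]; exact ⟨le_rfl, P.one_lt_R.le⟩)
    have hv : velocity P.eigenfunction 1 = 0 := by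
      refine Prod.ext ?_ ?_
      all_goals
        refine integral_eq_zero_of_ae ?_
        filter_upwards [h0] with x hx
        rw [hx, smul_zero]
        rfl
    have hne := P.Z_sub_c_ne_zero 1
    rw [hv, hz, stream, P.F_one] at h1
    simp at h1
    exact hne h1
  · rw [funext P.opK_eigenfunction]
    exact hmem _ (by fun_prop)
  · refine Eventually.of_forall fun x => ?_
    simp only [P.opK_eigenfunction]
    ring

end UnstableProfile

end Euler2D

end

theorem mainTheorem2 :
    ∃ Ω : ℂ → ℝ, ContDiff ℝ ∞ Ω ∧ HasCompactSupport Ω ∧ Euler2D.IsVortex Ω ∧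
      (∫ x : ℂ, Ω x) = 0 ∧ Euler2D.IsUnstable Ω := by
  obtain ⟨P⟩ := Euler2D.nonempty_unstableProfile
  exact ⟨P.vortex, P.contDiff_vortex, P.hasCompactSupport_vortex, ⟨fun r => P.vort (r ^ 2), fun _ => rfl⟩,
    P.integral_vortex, P.isUnstable_vortex⟩
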